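/- Let $X$ be a real Hilbert space, let $A$ be a nonempty closed convex subset of $X$, and let $B$ be a nonempty closed affine subspace of $X$. For a nonempty closed convex set $C\subseteq X$ let $P_C$ denote the projector onto $C$ (so $P_Cx$ is the unique point of $C$ nearest to $x$) and let $R_C := 2P_C-\mathrm{Id}$ be the reflector. Let $$T := \tfrac12(\mathrm{Id}+R_BR_A)=\mathrm{Id}-P_A+P_BR_A$$ be the Douglas--Rachford operator of the ordered pair $(A,B)$. Let $g := P_{\overline{B-A}}\,0$, where $B-A=\{b-a : a\in A,\ b\in B\}$, and assume that $g\in B-A$. Then for every $x\in X$: 1. the sequence $(P_AT^nx)_{n\in\mathbb N}$ converges weakly to some point of $E := A\cap(B-g)$; 2. the sequence $(P_BT^nx)_{n\in\mathbb N}$ converges weakly to some point of $F := (A+g)\cap B$. -/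

import Mathlib

open Filter Topology
open scoped Pointwise

namespace DouglasRachford

noncomputable section

variable {X : Type*} [NormedAddCommGroup X] [InnerProductSpace ℝ X]

/-- `p` is a nearest point of the set `C` to the point `x`. -/
def IsNearestPoint (C : Set X) (x p : X) : Prop :=
  p ∈ C ∧ ∀ y ∈ C, ‖x - p‖ ≤ ‖x - y‖

/-- In a Hilbert space every point has a nearest point in a nonempty closed convex set. -/
theorem exists_isNearestPoint [CompleteSpace X] {C : Set X} (hne : C.Nonempty)
    (hcl : IsClosed C) (hconv : Convex ℝ C) (x : X) : ∃ p, IsNearestPoint C x p := by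
  obtain ⟨p, hp, h⟩ := exists_norm_eq_iInf_of_complete_convex hne hcl.isComplete hconv x
  refine ⟨p, hp, fun y hy => ?_⟩
  rw [h]
  exact ciInf_le ⟨0, Set.forall_mem_range.2 fun _ => norm_nonneg _⟩ (⟨y, hy⟩ : C)

/-- The nearest point of a convex set is unique. -/
theorem IsNearestPoint.unique {C : Set X} (hconv : Convex ℝ C) {x p q : X}
    (hp : IsNearestPoint C x p) (hq : IsNearestPoint C x q) : p = q := by
  have hm : (1 / 2 : ℝ) • p + (1 / 2 : ℝ) • q ∈ C :=
    hconv hp.1 hq.1 (by norm_num) (by norm_num) (by norm_num)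
  have h1 := hp.2 _ hm
  have h2 := hq.2 _ hp.1
  have h3 := hp.2 _ hq.1
  have hpar := parallelogram_law_with_norm ℝ (x - p) (x - q)
  have e1 : (x - p) + (x - q) = (2 : ℝ) • (x - ((1 / 2 : ℝ) • p + (1 / 2 : ℝ) • q)) := by
    module
  have e2 : (x - p) - (x - q) = q - p := by abel
  rw [e1, e2, norm_smul, Real.norm_of_nonneg (by norm_num : (0 : ℝ) ≤ 2)] at hpar
  have h4 : ‖q - p‖ = 0 := by
    nlinarith [norm_nonneg (q - p), norm_nonneg (x - p), norm_nonneg (x - q)]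
  exact (sub_eq_zero.1 (norm_eq_zero.1 h4)).symm

open Classical in
/-- The projector `P_C`: it maps `x` to the nearest point of `C` to `x`. (The value `x` where
there is no nearest point is never used for nonempty closed convex `C` in a Hilbert space.) -/
def proj (C : Set X) (x : X) : X :=
  if h : ∃ p, IsNearestPoint C x p then h.choose else x

theorem isNearestPoint_proj [CompleteSpace X] {C : Set X} (hne : C.Nonempty)
    (hcl : IsClosed C) (hconv : Convex ℝ C) (x : X) : IsNearestPoint C x (proj C x) := by
  have h := exists_isNearestPoint hne hcl hconv x
  rw [proj, dif_pos h]
  exact h.choose_spec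

/-- The reflector `R_C = 2 P_C - Id`. -/
def reflector (C : Set X) (x : X) : X := (2 : ℝ) • proj C x - x

/-- The Douglas–Rachford operator `T = (Id + R_B R_A) / 2` of the ordered pair `(A, B)`. -/
def drOp (A B : Set X) (x : X) : X := (1 / 2 : ℝ) • (x + reflector B (reflector A x))

theorem drOp_eq (A B : Set X) (x : X) : drOp A B x = x - proj A x + proj B (reflector A x) := by
  simp only [drOp, reflector]
  module

/-- The gap vector `g`: the projection of `0` onto the closure of the Minkowski difference
`B - A = {b - a | a ∈ A, b ∈ B}`. -/
def gap (A B : Set X) : X := proj (closure (B - A)) 0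

/-- The set `E = A ∩ (B - g)`. -/
def setE (A B : Set X) : Set X := A ∩ (B - {gap A B})

/-- The set `F = (A + g) ∩ B`. -/
def setF (A B : Set X) : Set X := (A + {gap A B}) ∩ B

/-- Weak convergence of the sequence `u` to `p`: convergence in the weak topology of `X`. -/
def WeaklyConvergesTo (u : ℕ → X) (p : X) : Prop :=
  Tendsto (fun n => toWeakSpace ℝ X (u n)) atTop (𝓝 (toWeakSpace ℝ X p))

end

end DouglasRachford

open Filter Topology
open scoped Pointwise InnerProductSpace

namespace DouglasRachford

/-! ### Weak convergence via inner products and ultrafilters. -/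

section WeakConvergence

variable {X : Type*} [NormedAddCommGroup X] [InnerProductSpace ℝ X] [CompleteSpace X]

/-! Let `L` be the direction of `B`, `e ∈ E`, `u_n = T^n x - n g - e` and `d_n = P_A T^n x - e`.
Since `g ⟂ L`, one step reads `u_{n+1} = u_n - d_n + P_L (2 d_n - u_n)`, and `norm_sq_step_le` makes
`‖u_n‖` decrease with `d_n - P_L d_n → 0`. As `P_L u_{n+1} = P_L d_n`, the shadows `P_A T^n x` are
bounded, and their weak cluster points lie in `A` and in `e + L = B - g`, hence in `E`. Comparing
the convergent norms for two centres in `E` leaves only one cluster point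
(`exists_weaklyConvergesTo`, Opial's argument). The `B`-shadows follow by applying `P_L`. -/

theorem weaklyConvergesTo_iff_inner {u : ℕ → X} {p : X} :
    WeaklyConvergesTo u p ↔ ∀ z, Tendsto (fun n => ⟪z, u n⟫_ℝ) atTop (𝓝 ⟪z, p⟫_ℝ) := by
  have hinj : Function.Injective (topDualPairing ℝ X).flip := by
    intro x y hxy
    refine ext_inner_left ℝ fun v => ?_
    exact LinearMap.congr_fun hxy (InnerProductSpace.toDual ℝ X v)
  refine (WeakBilin.tendsto_iff_forall_eval_tendsto (topDualPairing ℝ X).flip hinj).trans ?_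
  refine ⟨fun h z => h (InnerProductSpace.toDual ℝ X z), fun h f => ?_⟩
  obtain ⟨z, rfl⟩ := (InnerProductSpace.toDual ℝ X).surjective f
  exact h z

/-- A bounded sequence in a Hilbert space converges weakly along every ultrafilter. -/
theorem exists_tendsto_inner_ultrafilter {u : ℕ → X} {C : ℝ} (hu : ∀ n, ‖u n‖ ≤ C)
    (U : Ultrafilter ℕ) : ∃ p, ∀ z, Tendsto (fun n => ⟪z, u n⟫_ℝ) U (𝓝 ⟪z, p⟫_ℝ) := by
  have hmem : ∀ n, StrongDual.toWeakDual (InnerProductSpace.toDual ℝ X (u n)) ∈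
      WeakDual.toStrongDual ⁻¹' Metric.closedBall (0 : StrongDual ℝ X) C := by
    intro n
    simpa using hu n
  -- Banach–Alaoglu, transported through the Riesz isometry.
  obtain ⟨f, -, hf⟩ := (WeakDual.isCompact_closedBall (𝕜 := ℝ) (0 : StrongDual ℝ X) C
    |>.ultrafilter_le_nhds (U.map _) (by
      rw [le_principal_iff]
      exact Ultrafilter.mem_map.2 (Eventually.of_forall hmem)))
  obtain ⟨p, hp⟩ := (InnerProductSpace.toDual ℝ X).surjective (WeakDual.toStrongDual f)
  refine ⟨p, fun z => ?_⟩
  have h : Tendsto (fun n => StrongDual.toWeakDual (InnerProductSpace.toDual ℝ X (u n))) U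
      (𝓝 f) := hf
  have h2 := ((WeakDual.eval_continuous z).tendsto f).comp h
  have h3 : f z = ⟪z, p⟫_ℝ := by
    rw [real_inner_comm]
    exact (DFunLike.congr_fun hp z).symm
  rw [← h3]
  refine h2.congr fun n => ?_
  exact real_inner_comm z (u n)

/-- A bounded sequence whose weak cluster points lie in `S` converges weakly to a point of `S` as
soon as its inner products with differences of points of `S` converge. -/
theorem exists_weaklyConvergesTo {u : ℕ → X} {C : ℝ} (hu : ∀ n, ‖u n‖ ≤ C) {S : Set X}
    (hS : ∀ (U : Ultrafilter ℕ) (p : X), (U : Filter ℕ) ≤ atTop →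
      (∀ z, Tendsto (fun n => ⟪z, u n⟫_ℝ) U (𝓝 ⟪z, p⟫_ℝ)) → p ∈ S)
    (hlim : ∀ p ∈ S, ∀ q ∈ S, ∃ l, Tendsto (fun n => ⟪p - q, u n⟫_ℝ) atTop (𝓝 l)) :
    ∃ p ∈ S, WeaklyConvergesTo u p := by
  obtain ⟨p, hp⟩ := exists_tendsto_inner_ultrafilter hu (Ultrafilter.of atTop)
  have hpS := hS _ p (Ultrafilter.of_le _) hp
  refine ⟨p, hpS, weaklyConvergesTo_iff_inner.2 fun z => ?_⟩
  rw [tendsto_iff_ultrafilter]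
  intro U hU
  obtain ⟨q, hq⟩ := exists_tendsto_inner_ultrafilter hu U
  obtain ⟨l, hl⟩ := hlim p hpS q (hS U q hU hq)
  have h1 := tendsto_nhds_unique (hp (p - q)) (hl.mono_left (Ultrafilter.of_le _))
  have h2 := tendsto_nhds_unique (hq (p - q)) (hl.mono_left hU)
  -- Both cluster points have the same inner product `l` with `p - q`.
  have h3 : ⟪p - q, p - q⟫_ℝ = 0 := by
    rw [inner_sub_right, h1, h2, sub_self]
  rw [sub_eq_zero.1 (inner_self_eq_zero.1 h3)]
  exact hq z

end WeakConvergence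

/-! ### Projections and the one-step estimate. -/

section NearestPoint

variable {X : Type*} [NormedAddCommGroup X] [InnerProductSpace ℝ X]

theorem IsNearestPoint.inner_le_zero {C : Set X} (hconv : Convex ℝ C) {x p y : X}
    (hp : IsNearestPoint C x p) (hy : y ∈ C) : ⟪x - p, y - p⟫_ℝ ≤ 0 := by
  refine (norm_eq_iInf_iff_real_inner_le_zero hconv hp.1).1 ?_ y hy
  have : Nonempty C := ⟨⟨p, hp.1⟩⟩
  exact le_antisymm (le_ciInf fun w => hp.2 _ w.2)
    (ciInf_le ⟨0, Set.forall_mem_range.2 fun _ => norm_nonneg _⟩ (⟨p, hp.1⟩ : C))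

/-- The projector onto an affine subspace in terms of the projector onto its direction. -/
theorem proj_affineSubspace (B : AffineSubspace ℝ X) [B.direction.HasOrthogonalProjection]
    {b : X} (hb : b ∈ B) (z : X) :
    proj (B : Set X) z = b + B.direction.starProjection (z - b) := by
  have h : IsNearestPoint (B : Set X) z (b + B.direction.starProjection (z - b)) := by
    refine ⟨?_, fun y hy => ?_⟩
    · rw [add_comm]
      exact AffineSubspace.vadd_mem_of_mem_direction (Submodule.starProjection_apply_mem _ _) hb
    · have hyb : y - b ∈ B.direction := AffineSubspace.vsub_mem_direction hy hb
      have h1 := B.direction.starProjection_minimal (z - b)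
      have h2 : ‖z - b - B.direction.starProjection (z - b)‖ ≤ ‖z - b - (y - b)‖ := by
        rw [h1]
        exact ciInf_le ⟨0, Set.forall_mem_range.2 fun _ => norm_nonneg _⟩
          (⟨y - b, hyb⟩ : B.direction)
      simpa [sub_sub, sub_sub_sub_cancel_right] using h2
  have hex : ∃ p, IsNearestPoint (B : Set X) z p := ⟨_, h⟩
  rw [proj, dif_pos hex]
  exact hex.choose_spec.unique B.convex h

/-- The Fejér-type estimate behind the Douglas–Rachford step for a subspace. -/
theorem norm_sq_step_le (L : Submodule ℝ X) [L.HasOrthogonalProjection] {u d : X}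
    (h : 0 ≤ ⟪u - d, d⟫_ℝ) :
    ‖u - d + L.starProjection ((2 : ℝ) • d - u)‖ ^ 2 +
      (‖d - L.starProjection d‖ ^ 2 + ‖L.starProjection (u - d)‖ ^ 2) ≤ ‖u‖ ^ 2 := by
  have horth (v w : X) : ⟪v, L.starProjection w⟫_ℝ =
      ⟪L.starProjection v, L.starProjection w⟫_ℝ := by
    have := L.starProjection_inner_eq_zero v _ (L.starProjection_apply_mem w)
    rw [inner_sub_left] at this
    linarith
  have huu := horth u u
  have hud := horth u d
  have hdu := horth d u
  have hdd := horth d d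
  simp only [map_sub, map_smul]
  generalize L.starProjection u = p at *
  generalize L.starProjection d = q at *
  simp only [← real_inner_self_eq_norm_sq, inner_sub_left, inner_sub_right, inner_add_left,
    inner_add_right, inner_smul_left, inner_smul_right, RCLike.conj_to_real] at *
  have c1 := real_inner_comm u d
  have c2 := real_inner_comm u p
  have c3 := real_inner_comm u q
  have c4 := real_inner_comm d p
  have c5 := real_inner_comm d q
  have c6 := real_inner_comm p q
  -- The two sides of the goal differ by exactly `2⟪u - d, d⟫`.
  linarith

end NearestPoint

/-! ### Geometry of the gap vector. -/

section Gap

variable {X : Type*} [NormedAddCommGroup X]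

theorem mem_setE_iff {A B : Set X} {e : X} : e ∈ setE A B ↔ e ∈ A ∧ e + gap A B ∈ B := by
  simp [setE, Set.sub_singleton, sub_eq_iff_eq_add]

theorem add_gap_mem_setF {A B : Set X} {e : X} (he : e ∈ setE A B) :
    e + gap A B ∈ setF A B :=
  ⟨Set.add_mem_add (mem_setE_iff.1 he).1 rfl, (mem_setE_iff.1 he).2⟩

theorem setE_nonempty {A B : Set X} (hg : gap A B ∈ B - A) : (setE A B).Nonempty := by
  obtain ⟨b, hb, a, ha, hab⟩ := hg
  refine ⟨a, mem_setE_iff.2 ⟨ha, ?_⟩⟩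
  rw [← hab]
  simpa using hb

variable [InnerProductSpace ℝ X] [CompleteSpace X]

theorem inner_gap_nonneg {A B : Set X} (hA : Convex ℝ A) (hB : Convex ℝ B) {a b : X}
    (ha : a ∈ A) (hb : b ∈ B) : 0 ≤ ⟪gap A B, b - a - gap A B⟫_ℝ := by
  have hmem : b - a ∈ closure (B - A) := subset_closure (Set.sub_mem_sub hb ha)
  have hconv : Convex ℝ (closure (B - A)) := (hB.sub hA).closure
  have h := (isNearestPoint_proj ⟨_, hmem⟩ isClosed_closure hconv 0).inner_le_zero hconv hmem
  rw [zero_sub, inner_neg_left] at h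
  exact neg_nonpos.1 h

theorem inner_gap_sub_nonpos {A B : Set X} (hA : Convex ℝ A) (hB : Convex ℝ B) {a e : X}
    (ha : a ∈ A) (he : e ∈ setE A B) : ⟪gap A B, a - e⟫_ℝ ≤ 0 := by
  have h := inner_gap_nonneg hA hB ha (mem_setE_iff.1 he).2
  rw [show e + gap A B - a - gap A B = -(a - e) by abel, inner_neg_right] at h
  exact neg_nonneg.1 h

/-- Moving within `B` along `±v` keeps the variational inequality for the gap, which forces
equality. -/
theorem gap_mem_orthogonal {A : Set X} (hA : Convex ℝ A) (B : AffineSubspace ℝ X)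
    (hg : gap A (B : Set X) ∈ (B : Set X) - A) : gap A (B : Set X) ∈ B.directionᗮ := by
  obtain ⟨e, he⟩ := setE_nonempty hg
  obtain ⟨heA, heB⟩ := mem_setE_iff.1 he
  have key : ∀ v ∈ B.direction, 0 ≤ ⟪gap A (B : Set X), v⟫_ℝ := by
    intro v hv
    have h := inner_gap_nonneg hA B.convex heA
      (AffineSubspace.vadd_mem_of_mem_direction hv heB)
    rwa [vadd_eq_add, show v + (e + gap A (B : Set X)) - e - gap A (B : Set X) = v by abel] at h
  rw [Submodule.mem_orthogonal']
  intro v hv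
  have h := key (-v) (neg_mem hv)
  rw [inner_neg_right] at h
  exact le_antisymm (neg_nonneg.1 h) (key v hv)

end Gap

/-! ### The recentred iteration and its limits. -/

section Iteration

variable {X : Type*} [NormedAddCommGroup X] [InnerProductSpace ℝ X] [CompleteSpace X]
  {A : Set X} {B : AffineSubspace ℝ X} [B.direction.HasOrthogonalProjection]

/-- One Douglas–Rachford step, recentred at `e ∈ E` and corrected by a multiple of the gap. -/
theorem drOp_sub_eq (hA : Convex ℝ A) (hg : gap A (B : Set X) ∈ (B : Set X) - A)
    {e : X} (he : e ∈ setE A (B : Set X)) (z : X) (t : ℝ) :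
    drOp A (B : Set X) z - (t + 1) • gap A (B : Set X) - e =
      (z - t • gap A (B : Set X) - e) - (proj A z - e) + B.direction.starProjection
        ((2 : ℝ) • (proj A z - e) - (z - t • gap A (B : Set X) - e)) := by
  have hP : B.direction.starProjection (gap A (B : Set X)) = 0 :=
    (Submodule.starProjection_apply_eq_zero_iff _).2 (gap_mem_orthogonal hA B hg)
  rw [drOp_eq, proj_affineSubspace B (mem_setE_iff.1 he).2, reflector]
  simp only [map_sub, map_add, map_smul, hP]
  module

variable (hA_closed : IsClosed A) (hA : Convex ℝ A)
  (hg : gap A (B : Set X) ∈ (B : Set X) - A) {e : X} (he : e ∈ setE A (B : Set X)) (x : X)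

include hA_closed hA hg he

theorem norm_sq_iterate_step_le (n : ℕ) :
    ‖(drOp A (B : Set X))^[n + 1] x - ((n + 1 : ℕ) : ℝ) • gap A (B : Set X) - e‖ ^ 2 +
      ‖proj A ((drOp A (B : Set X))^[n] x) - e -
        B.direction.starProjection (proj A ((drOp A (B : Set X))^[n] x) - e)‖ ^ 2 ≤
    ‖(drOp A (B : Set X))^[n] x - (n : ℝ) • gap A (B : Set X) - e‖ ^ 2 := by
  rw [Function.iterate_succ_apply', Nat.cast_add_one, drOp_sub_eq hA hg he]
  generalize (drOp A (B : Set X))^[n] x = z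
  have heA := (mem_setE_iff.1 he).1
  have hp := isNearestPoint_proj ⟨e, heA⟩ hA_closed hA z
  have h1 := hp.inner_le_zero hA heA
  have h2 := inner_gap_sub_nonpos hA B.convex hp.1 he
  have h3 : 0 ≤ ⟪(z - (n : ℝ) • gap A (B : Set X) - e) - (proj A z - e), proj A z - e⟫_ℝ := by
    rw [show (z - (n : ℝ) • gap A (B : Set X) - e) - (proj A z - e) =
      (z - proj A z) - (n : ℝ) • gap A (B : Set X) by abel, inner_sub_left, real_inner_smul_left]
    rw [← neg_sub (proj A z) e, inner_neg_right] at h1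
    -- The drift term `-n⟪g, P_A z - e⟫` has the favourable sign.
    have := mul_nonneg n.cast_nonneg (neg_nonneg.2 h2)
    linarith
  have h4 := norm_sq_step_le B.direction h3
  linarith [sq_nonneg ‖B.direction.starProjection
    ((z - (n : ℝ) • gap A (B : Set X) - e) - (proj A z - e))‖]

theorem antitone_norm_sq_iterate : Antitone fun n : ℕ =>
    ‖(drOp A (B : Set X))^[n] x - (n : ℝ) • gap A (B : Set X) - e‖ ^ 2 :=
  antitone_nat_of_succ_le fun n => by
    have h := norm_sq_iterate_step_le hA_closed hA hg he x n
    exact le_trans (le_add_of_nonneg_right (sq_nonneg _)) h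

theorem exists_tendsto_norm_sq_iterate : ∃ l, Tendsto (fun n : ℕ =>
    ‖(drOp A (B : Set X))^[n] x - (n : ℝ) • gap A (B : Set X) - e‖ ^ 2) atTop (𝓝 l) :=
  ⟨_, tendsto_atTop_ciInf (antitone_norm_sq_iterate hA_closed hA hg he x)
    ⟨0, Set.forall_mem_range.2 fun _ => sq_nonneg _⟩⟩

theorem tendsto_residual : Tendsto (fun n : ℕ => proj A ((drOp A (B : Set X))^[n] x) - e -
    B.direction.starProjection (proj A ((drOp A (B : Set X))^[n] x) - e)) atTop (𝓝 0) := by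
  obtain ⟨l, hl⟩ := exists_tendsto_norm_sq_iterate hA_closed hA hg he x
  have h := hl.sub ((tendsto_add_atTop_iff_nat 1).2 hl)
  rw [sub_self] at h
  have h2 := squeeze_zero (fun _ => sq_nonneg _) (fun n => le_sub_iff_add_le'.2
    (norm_sq_iterate_step_le hA_closed hA hg he x n)) h
  rw [tendsto_zero_iff_norm_tendsto_zero]
  simpa using h2.sqrt

omit hA_closed in
theorem starProjection_iterate_succ (n : ℕ) :
    B.direction.starProjection
      ((drOp A (B : Set X))^[n + 1] x - ((n + 1 : ℕ) : ℝ) • gap A (B : Set X) - e) =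
    B.direction.starProjection (proj A ((drOp A (B : Set X))^[n] x) - e) := by
  rw [Function.iterate_succ_apply', Nat.cast_add_one, drOp_sub_eq hA hg he, map_add,
    Submodule.starProjection_eq_self_iff.2 (Submodule.starProjection_apply_mem _ _), ← map_add]
  congr 1
  module

/-- The components of `d_n` in `L` and in `Lᗮ` are each at most `‖x - e‖`: the first is `P_L
u_{n+1}`, the second is the residual. -/
theorem norm_proj_iterate_le (n : ℕ) :
    ‖proj A ((drOp A (B : Set X))^[n] x)‖ ≤ 2 * ‖x - e‖ + ‖e‖ := by
  have hle (m : ℕ) : ‖(drOp A (B : Set X))^[m] x - (m : ℝ) • gap A (B : Set X) - e‖ ≤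
      ‖x - e‖ := by
    have h := antitone_norm_sq_iterate hA_closed hA hg he x (Nat.zero_le m)
    simp only [Function.iterate_zero, id, Nat.cast_zero, zero_smul, sub_zero] at h
    exact le_of_sq_le_sq h (norm_nonneg _)
  have h1 : ‖B.direction.starProjection (proj A ((drOp A (B : Set X))^[n] x) - e)‖ ≤
      ‖x - e‖ := by
    rw [← starProjection_iterate_succ hA hg he x n]
    exact (Submodule.norm_starProjection_apply_le _ _).trans (hle (n + 1))
  have h2 : ‖proj A ((drOp A (B : Set X))^[n] x) - e -
      B.direction.starProjection (proj A ((drOp A (B : Set X))^[n] x) - e)‖ ≤ ‖x - e‖ := by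
    refine le_trans (le_of_sq_le_sq ?_ (norm_nonneg _)) (hle n)
    exact le_trans (le_add_of_nonneg_left (sq_nonneg _))
      (norm_sq_iterate_step_le hA_closed hA hg he x n)
  generalize proj A ((drOp A (B : Set X))^[n] x) = a at *
  calc ‖a‖ = ‖(a - e - B.direction.starProjection (a - e)) +
        B.direction.starProjection (a - e) + e‖ := by congr 1; abel
    _ ≤ _ := norm_add₃_le
    _ ≤ _ := by linarith

theorem mem_setE_of_tendsto_inner (U : Ultrafilter ℕ) {p : X} (hU : (U : Filter ℕ) ≤ atTop)
    (hp : ∀ z, Tendsto (fun n => ⟪z, proj A ((drOp A (B : Set X))^[n] x)⟫_ℝ) U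
      (𝓝 ⟪z, p⟫_ℝ)) : p ∈ setE A (B : Set X) := by
  obtain ⟨heA, heB⟩ := mem_setE_iff.1 he
  have hproj := fun z => isNearestPoint_proj ⟨e, heA⟩ hA_closed hA z
  refine mem_setE_iff.2 ⟨?_, ?_⟩
  -- `A` is weakly closed: the half-space at `P_A p` that contains `A` also contains `p`.
  · have h1 := (hp (p - proj A p)).sub_const ⟪p - proj A p, proj A p⟫_ℝ
    have h2 : ⟪p - proj A p, p⟫_ℝ - ⟪p - proj A p, proj A p⟫_ℝ ≤ 0 := by
      refine le_of_tendsto' h1 fun n => ?_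
      rw [← inner_sub_right]
      exact (hproj p).inner_le_zero hA (hproj _).1
    rw [← inner_sub_right] at h2
    rw [sub_eq_zero.1 (inner_self_eq_zero.1 (le_antisymm h2 real_inner_self_nonneg))]
    exact (hproj p).1
  · set v := p - e - B.direction.starProjection (p - e) with hv
    have hvL : v ∈ B.directionᗮ := Submodule.sub_starProjection_mem_orthogonal _
    have hvP (w : X) : ⟪v, w - B.direction.starProjection w⟫_ℝ = ⟪v, w⟫_ℝ := by
      rw [inner_sub_right, Submodule.inner_left_of_mem_orthogonal
        (Submodule.starProjection_apply_mem _ _) hvL, sub_zero]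
    have h1 := (tendsto_const_nhds (x := v)).inner (𝕜 := ℝ)
      ((tendsto_residual hA_closed hA hg he x).mono_left hU)
    simp only [hvP, inner_zero_right] at h1
    have h2 := (hp v).sub_const ⟪v, e⟫_ℝ
    simp only [← inner_sub_right] at h2
    have h3 := tendsto_nhds_unique h2 h1
    rw [← hvP, ← hv] at h3
    have h4 : p - e ∈ B.direction := Submodule.starProjection_eq_self_iff.1
      (sub_eq_zero.1 (inner_self_eq_zero.1 h3)).symm
    have h5 := AffineSubspace.vadd_mem_of_mem_direction h4 heB
    rwa [vadd_eq_add, ← add_assoc, sub_add_cancel] at h5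

/-- Since `e - q ∈ L`, `d_n` may be replaced by `u_{n+1}`; polarization then expresses the product
through the two convergent squared norms. -/
theorem exists_tendsto_inner_sub {q : X} (hq : q ∈ setE A (B : Set X)) : ∃ l, Tendsto
    (fun n => ⟪e - q, proj A ((drOp A (B : Set X))^[n] x)⟫_ℝ) atTop (𝓝 l) := by
  obtain ⟨l₁, h₁⟩ := exists_tendsto_norm_sq_iterate hA_closed hA hg he x
  obtain ⟨l₂, h₂⟩ := exists_tendsto_norm_sq_iterate hA_closed hA hg hq x
  have hL : e - q ∈ B.direction := by
    have := AffineSubspace.vsub_mem_direction (mem_setE_iff.1 he).2 (mem_setE_iff.1 hq).2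
    rwa [vsub_eq_sub, add_sub_add_right_eq_sub] at this
  have hP (w : X) : ⟪e - q, B.direction.starProjection w⟫_ℝ = ⟪e - q, w⟫_ℝ := by
    rw [← Submodule.inner_starProjection_left_eq_right,
      Submodule.starProjection_eq_self_iff.2 hL]
  refine ⟨_, (((((h₂.sub h₁).sub_const (‖e - q‖ ^ 2)).div_const 2).comp
    (tendsto_add_atTop_nat 1)).add_const ⟪e - q, e⟫_ℝ).congr fun n => ?_⟩
  rw [← sub_add_cancel (proj A ((drOp A (B : Set X))^[n] x)) e, inner_add_right _ _ e,
    ← hP (_ - e), ← starProjection_iterate_succ hA hg he x n, hP]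
  simp only [Function.comp_apply]
  generalize (drOp A (B : Set X))^[n + 1] x - ((n + 1 : ℕ) : ℝ) • gap A (B : Set X) = y
  rw [show y - q = (y - e) + (e - q) by abel, norm_add_sq_real, real_inner_comm (e - q) (y - e)]
  ring

omit hA_closed in
theorem weaklyConvergesTo_proj_affineSubspace
    (h : WeaklyConvergesTo (fun n : ℕ => proj A ((drOp A (B : Set X))^[n] x)) e) :
    WeaklyConvergesTo (fun n : ℕ => proj (B : Set X) ((drOp A (B : Set X))^[n] x))
      (e + gap A (B : Set X)) := by
  have hP : B.direction.starProjection (gap A (B : Set X)) = 0 :=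
    (Submodule.starProjection_apply_eq_zero_iff _).2 (gap_mem_orthogonal hA B hg)
  rw [weaklyConvergesTo_iff_inner] at h ⊢
  intro z
  -- The shift is needed because `P_B T^{n+1} x = e + g + P_L d_n`.
  rw [← tendsto_add_atTop_iff_nat 1]
  have h1 := ((h (B.direction.starProjection z)).sub_const
    ⟪B.direction.starProjection z, e⟫_ℝ).const_add ⟪z, e + gap A (B : Set X)⟫_ℝ
  rw [sub_self, add_zero] at h1
  refine h1.congr fun n => ?_
  have h2 := starProjection_iterate_succ hA hg he x n
  rw [proj_affineSubspace B (mem_setE_iff.1 he).2,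
    inner_add_right _ (e + gap A (B : Set X)), ← inner_sub_right,
    Submodule.inner_starProjection_left_eq_right, ← h2]
  simp only [map_sub, map_add, map_smul, hP, smul_zero, sub_zero, add_zero]

end Iteration

end DouglasRachford

theorem theorem2p5 {X : Type*} [NormedAddCommGroup X] [InnerProductSpace ℝ X] [CompleteSpace X]
    (A : Set X) (hA_nonempty : A.Nonempty) (hA_closed : IsClosed A) (hA_convex : Convex ℝ A)
    (B : AffineSubspace ℝ X) (hB_nonempty : (B : Set X).Nonempty)
    (hB_closed : IsClosed (B : Set X))
    (hg : DouglasRachford.gap A (B : Set X) ∈ (B : Set X) - A)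
    (x : X) :
    (∃ p ∈ DouglasRachford.setE A (B : Set X),
      DouglasRachford.WeaklyConvergesTo
        (fun n : ℕ => DouglasRachford.proj A ((DouglasRachford.drOp A (B : Set X))^[n] x)) p) ∧
    (∃ q ∈ DouglasRachford.setF A (B : Set X),
      DouglasRachford.WeaklyConvergesTo
        (fun n : ℕ =>
          DouglasRachford.proj (B : Set X) ((DouglasRachford.drOp A (B : Set X))^[n] x)) q) := by
  have : CompleteSpace B.direction :=
    (B.isClosed_direction_iff.2 hB_closed).completeSpace_coe
  obtain ⟨e, he⟩ := DouglasRachford.setE_nonempty hg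
  obtain ⟨p, hp, hlim⟩ := DouglasRachford.exists_weaklyConvergesTo
    (DouglasRachford.norm_proj_iterate_le hA_closed hA_convex hg he x)
    (fun U _ hU => DouglasRachford.mem_setE_of_tendsto_inner hA_closed hA_convex hg he x U hU)
    (fun _ hp _ hq =>
      DouglasRachford.exists_tendsto_inner_sub hA_closed hA_convex hg hp x hq)
  exact ⟨⟨p, hp, hlim⟩, _, DouglasRachford.add_gap_mem_setF hp,
    DouglasRachford.weaklyConvergesTo_proj_affineSubspace hA_convex hg hp x hlim⟩
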